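/- Let $\mathbb X\subset\mathbb R^d$ be a bounded set (for instance a set of $N$ points), let $P$ be a probability measure supported on $N$ points $\mathbf x_1,\dots,\mathbf x_N$ of $\mathbb X$, that is $P(\{\mathbf x_1,\dots,\mathbf x_N\})=1$, and let $Q$ be a Borel probability measure on $\mathbb R^d$ with $\int|\mathbf y|^2\,dQ(\mathbf y)<\infty$, where $|\cdot|$ is the Euclidean norm. Let $m\ge 1$, let $Y_1,\dots,Y_m$ be i.i.d. with law $Q$, and let $Q_m=\frac1m\sum_{k=1}^m\delta_{Y_k}$. Write $$\mathcal W_1(\mu,\nu)=\inf_{\pi\in\Pi(\mu,\nu)}\int|\mathbf x-\mathbf y|\,d\pi(\mathbf x,\mathbf y),$$ where $\Pi(\mu,\nu)$ is the set of couplings of $\mu$ and $\nu$. Then $\mathcal W_1(P,Q)$ and $\mathcal W_1(P,Q_m)$ are finite, $|\mathcal W_1(P,Q_m)-\mathcal W_1(P,Q)|$ is integrable, and $$E\left|\mathcal W_1(P,Q_m)-\mathcal W_1(P,Q)\right|\le\frac{8\sqrt{2N}}{\sqrt m}\,K(\mathbb X,Q),$$ where $$K(\mathbb X,Q)=\left(4\operatorname{diam}(\mathbb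 X)+2\sqrt{\int|\mathbf y|^2\,dQ(\mathbf y)}+2\operatorname{diam}(\mathbb X)\right)\left(\log 2+\sqrt{2\operatorname{diam}(\mathbb X)+1}\right).$$ -/

import Mathlib

open MeasureTheory ProbabilityTheory
open scoped ENNReal

/-- `π` is a coupling of `P` and `Q`: a measure on the product with marginals `P` and `Q`.
(It is a probability measure as soon as `P` is.) -/
structure IsCoupling {X Y : Type*} [MeasurableSpace X] [MeasurableSpace Y]
    (π : Measure (X × Y)) (P : Measure X) (Q : Measure Y) : Prop where
  map_fst : π.map Prod.fst = P
  map_snd : π.map Prod.snd = Q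

/-- The Kantorovich optimal transport cost between `P` and `Q` for a nonnegative cost `c`,
with values in `[0, ∞]`: the infimum of the total cost over all couplings. -/
noncomputable def transportCost {X Y : Type*} [MeasurableSpace X] [MeasurableSpace Y]
    (c : X → Y → ℝ) (P : Measure X) (Q : Measure Y) : ℝ≥0∞ :=
  ⨅ (π : Measure (X × Y)) (_ : IsCoupling π P Q), ∫⁻ z, ENNReal.ofReal (c z.1 z.2) ∂π

/-- The 1-Wasserstein distance on `ℝ^d`, with values in `[0, ∞]`: the optimal transport cost
for the Euclidean distance. -/
noncomputable def wasserstein1 {d : ℕ} (P Q : Measure (EuclideanSpace ℝ (Fin d))) : ℝ≥0∞ :=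
  transportCost (fun x y => ‖x - y‖) P Q

/-- The empirical measure `(1/m) ∑ δ_{y k}` of the points `y 0, …, y (m - 1)`, for `m ≥ 1`. -/
noncomputable def empiricalMeasure {E : Type*} [MeasurableSpace E] {m : ℕ} (y : Fin m → E) :
    Measure E :=
  (m : ℝ≥0∞)⁻¹ • ∑ k, Measure.dirac (y k)

/-- The constant `K(𝕏, Q)`, where `𝕏` is a bounded set and `Q` has a finite second moment. -/
noncomputable def boundConstant {d : ℕ} (A : Set (EuclideanSpace ℝ (Fin d)))
    (Q : Measure (EuclideanSpace ℝ (Fin d))) : ℝ :=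
  (4 * Metric.diam A + 2 * √(∫ y, ‖y‖ ^ 2 ∂Q) + 2 * Metric.diam A)
    * (Real.log 2 + √(2 * Metric.diam A + 1))

/-! The transport problem from a measure on `N` sites is finite dimensional on the dual side, and
both sides can be tested against functions chosen from `Q` alone. Let `D` bound the distances
between sites, and let `σ` be the root of the second moment of `Q`.

A transport plan is a partition of unity `w` with masses `p`. This constraint is replaced by the
penalty `D ∑ |p i - ∫ w i|`. The penalty is exact: wrong masses can be repaired by moving mass
between sites at unit price at most `D` (`IsMeasurablePartition.exists_masses_eq`), so every `w`
gives an upper bound on the cost. Dually, the penalty forces the optimal potential to satisfy `|g i|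
≤ D` (`exists_dual_potential`).

Fix an optimal `g` and an almost optimal `w` for `Q`. Used unchanged against `Q_m`, `g` bounds the
cost below and `w` bounds it above. The deviation is therefore controlled by the empirical errors of
`N + 2` fixed functions (`exists_abs_discreteTransportCost_sub_le`), with no supremum over a
function class. Each error has mean at most its standard deviation over `√m`. Summing gives `√N (4 D
+ 2 σ) / √m`, which the stated constant dominates. -/

/-- A measurable partition of unity indexed by `ι`: at each point `y`, the weights `w i y` are
nonnegative and sum to one. -/
structure IsMeasurablePartition {ι Y : Type*} [Fintype ι] [MeasurableSpace Y]
    (w : ι → Y → ℝ) : Prop where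
  measurable : ∀ i, Measurable (w i)
  nonneg : ∀ i y, 0 ≤ w i y
  sum_eq_one : ∀ y, ∑ i, w i y = 1

/-- The cost of sending the fraction `w i y` of the mass of `ν` at `y` to the `i`-th target, at the
price `c i y`, with the penalty `L ∑ i, |p i - ∫ w i|` for missing the prescribed masses `p`. -/
noncomputable def penalizedCost {ι Y : Type*} [Fintype ι] [MeasurableSpace Y]
    (c : ι → Y → ℝ) (L : ℝ) (ν : Measure Y) (p : ι → ℝ) (w : ι → Y → ℝ) : ℝ :=
  ∫ y, ∑ i, w i y * c i y ∂ν + L * ∑ i, |p i - ∫ y, w i y ∂ν|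

/-- The semi-discrete `c`-transform `y ↦ min i, (c i y - g i)`. -/
noncomputable def cTransform {ι Y : Type*} [Fintype ι] [Nonempty ι]
    (c : ι → Y → ℝ) (g : ι → ℝ) (y : Y) : ℝ :=
  Finset.univ.inf' Finset.univ_nonempty fun i => c i y - g i

/-! ### Semi-discrete `c`-transforms. -/

section CTransform

variable {ι Y : Type*} [Fintype ι] [Nonempty ι] {c : ι → Y → ℝ} {g : ι → ℝ}

lemma cTransform_le (c : ι → Y → ℝ) (g : ι → ℝ) (y : Y) (i : ι) :
    cTransform c g y ≤ c i y - g i :=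
  Finset.inf'_le _ (Finset.mem_univ i)

lemma exists_cTransform_eq (c : ι → Y → ℝ) (g : ι → ℝ) (y : Y) :
    ∃ i, cTransform c g y = c i y - g i := by
  obtain ⟨i, -, hi⟩ := Finset.exists_mem_eq_inf' Finset.univ_nonempty fun i => c i y - g i
  exact ⟨i, hi⟩

variable [MeasurableSpace Y]

lemma measurable_cTransform (hc : ∀ i, Measurable (c i)) : Measurable (cTransform c g) := by
  have : cTransform c g = Finset.univ.inf' Finset.univ_nonempty fun i y => c i y - g i := by
    ext y
    simp [cTransform, Finset.inf'_apply]
  rw [this]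
  exact Finset.inf'_induction (p := Measurable) _ _ (fun _ hf _ hf' => hf.inf hf')
    fun i _ => (hc i).sub_const _

lemma integrable_cTransform {ν : Measure Y} [IsFiniteMeasure ν] (hc : ∀ i, Measurable (c i))
    (hci : ∀ i, Integrable (c i) ν) : Integrable (cTransform c g) ν := by
  refine Integrable.mono' (g := fun y => ∑ i, |c i y - g i|) ?_
    (measurable_cTransform hc).aestronglyMeasurable (.of_forall fun y => ?_)
  · exact integrable_finsetSum _ fun i _ => ((hci i).sub (integrable_const _)).abs
  · obtain ⟨i, hi⟩ := exists_cTransform_eq c g y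
    rw [hi, Real.norm_eq_abs]
    exact Finset.single_le_sum (f := fun i => |c i y - g i|) (fun _ _ => abs_nonneg _)
      (Finset.mem_univ i)

/-- The minimizing cells of a `c`-transform yield a measurable partition attaining it. -/
lemma exists_partition_eq_cTransform (hc : ∀ i, Measurable (c i)) :
    ∃ w : ι → Y → ℝ, IsMeasurablePartition w ∧
      ∀ y, ∑ i, w i y * (c i y - g i) = cTransform c g y := by
  classical
  -- Ties between minimizing indices are shared equally after normalization, so no measurable
  -- selection is needed.
  let a : ι → Y → ℝ := fun i => {y | c i y - g i = cTransform c g y}.indicator 1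
  have ha : ∀ i, Measurable (a i) := fun i =>
    measurable_one.indicator (measurableSet_eq_fun ((hc i).sub_const _) (measurable_cTransform hc))
  have ha0 : ∀ i y, 0 ≤ a i y := fun i y => Set.indicator_nonneg (fun _ _ => zero_le_one) y
  have hpos : ∀ y, 0 < ∑ j, a j y := by
    intro y
    obtain ⟨i, hi⟩ := exists_cTransform_eq c g y
    refine Finset.sum_pos' (fun j _ => ha0 j y) ⟨i, Finset.mem_univ i, ?_⟩
    simp [a, hi]
  refine ⟨fun i y => a i y / ∑ j, a j y, ⟨fun i => ?_, fun i y => ?_, fun y => ?_⟩, fun y => ?_⟩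
  · exact (ha i).div (Finset.measurable_sum _ fun j _ => ha j)
  · exact div_nonneg (ha0 i y) (hpos y).le
  · rw [← Finset.sum_div, div_self (hpos y).ne']
  · have : ∀ i, a i y / (∑ j, a j y) * (c i y - g i)
        = a i y / (∑ j, a j y) * cTransform c g y := by
      intro i
      by_cases h : c i y - g i = cTransform c g y
      · rw [h]
      · simp [a, h]
    simp_rw [this]
    rw [← Finset.sum_mul, ← Finset.sum_div, div_self (hpos y).ne', one_mul]

end CTransform

/-! ### Strong duality with penalized masses. -/

section Duality

variable {ι Y : Type*} [Fintype ι] [MeasurableSpace Y] {c : ι → Y → ℝ} {w w' : ι → Y → ℝ}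
  {ν : Measure Y}

lemma IsMeasurablePartition.le_one (hw : IsMeasurablePartition w) (i : ι) (y : Y) :
    w i y ≤ 1 := by
  rw [← hw.sum_eq_one y]
  exact Finset.single_le_sum (f := fun i => w i y) (fun j _ => hw.nonneg j y) (Finset.mem_univ i)

lemma IsMeasurablePartition.abs_le_one (hw : IsMeasurablePartition w) (i : ι) (y : Y) :
    |w i y| ≤ 1 := by
  rw [abs_of_nonneg (hw.nonneg i y)]
  exact hw.le_one i y

lemma IsMeasurablePartition.integrable [IsFiniteMeasure ν] (hw : IsMeasurablePartition w)
    (i : ι) : Integrable (w i) ν :=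
  Integrable.of_bound (hw.measurable i).aestronglyMeasurable 1
    (.of_forall fun y => hw.abs_le_one i y)

lemma IsMeasurablePartition.integrable_mul (hw : IsMeasurablePartition w) {f : Y → ℝ}
    (hf : Integrable f ν) (i : ι) : Integrable (fun y => w i y * f y) ν :=
  hf.bdd_mul (hw.measurable i).aestronglyMeasurable (.of_forall fun y => hw.abs_le_one i y)

lemma IsMeasurablePartition.integrable_sum_mul (hw : IsMeasurablePartition w)
    (hci : ∀ i, Integrable (c i) ν) : Integrable (fun y => ∑ i, w i y * c i y) ν :=
  integrable_finsetSum _ fun i _ => hw.integrable_mul (hci i) i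

lemma IsMeasurablePartition.sum_integral_eq_one [IsProbabilityMeasure ν]
    (hw : IsMeasurablePartition w) : ∑ i, ∫ y, w i y ∂ν = 1 := by
  rw [← integral_finsetSum _ fun i _ => hw.integrable i]
  simp [hw.sum_eq_one]

lemma IsMeasurablePartition.convexCombination (hw : IsMeasurablePartition w)
    (hw' : IsMeasurablePartition w') {a b : ℝ} (ha : 0 ≤ a) (hb : 0 ≤ b) (hab : a + b = 1) :
    IsMeasurablePartition fun i y => a * w i y + b * w' i y where
  measurable i := ((hw.measurable i).const_mul a).add ((hw'.measurable i).const_mul b)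
  nonneg i y := add_nonneg (mul_nonneg ha (hw.nonneg i y)) (mul_nonneg hb (hw'.nonneg i y))
  sum_eq_one y := by
    rw [Finset.sum_add_distrib, ← Finset.mul_sum, ← Finset.mul_sum, hw.sum_eq_one,
      hw'.sum_eq_one, mul_one, mul_one, hab]

lemma isMeasurablePartition_single [DecidableEq ι] (i : ι) :
    IsMeasurablePartition fun (j : ι) (_ : Y) => if j = i then (1 : ℝ) else 0 where
  measurable _ := measurable_const
  nonneg _ _ := by split_ifs <;> simp
  sum_eq_one _ := by simp

/-- The penalized cost is jointly convex in the prescribed masses and the partition. -/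
lemma penalizedCost_convexCombination [IsFiniteMeasure ν] (hci : ∀ i, Integrable (c i) ν)
    {L : ℝ} (hL : 0 ≤ L) (hw : IsMeasurablePartition w) (hw' : IsMeasurablePartition w')
    (p p' : ι → ℝ) {a b : ℝ} (ha : 0 ≤ a) (hb : 0 ≤ b) :
    penalizedCost c L ν (fun i => a * p i + b * p' i) (fun i y => a * w i y + b * w' i y)
      ≤ a * penalizedCost c L ν p w + b * penalizedCost c L ν p' w' := by
  have h1 : ∫ y, ∑ i, (a * w i y + b * w' i y) * c i y ∂ν
      = a * ∫ y, ∑ i, w i y * c i y ∂ν + b * ∫ y, ∑ i, w' i y * c i y ∂ν := by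
    rw [← integral_const_mul, ← integral_const_mul,
      ← integral_add ((hw.integrable_sum_mul hci).const_mul a)
        ((hw'.integrable_sum_mul hci).const_mul b)]
    congr with y
    rw [Finset.mul_sum, Finset.mul_sum, ← Finset.sum_add_distrib]
    exact Finset.sum_congr rfl fun i _ => by ring
  have h2 : ∀ i, ∫ y, (a * w i y + b * w' i y) ∂ν
      = a * ∫ y, w i y ∂ν + b * ∫ y, w' i y ∂ν := fun i => by
    rw [integral_add ((hw.integrable i).const_mul a) ((hw'.integrable i).const_mul b),
      integral_const_mul, integral_const_mul]
  have h3 : ∑ i, |a * p i + b * p' i - ∫ y, (a * w i y + b * w' i y) ∂ν|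
      ≤ a * ∑ i, |p i - ∫ y, w i y ∂ν| + b * ∑ i, |p' i - ∫ y, w' i y ∂ν| := by
    rw [Finset.mul_sum, Finset.mul_sum, ← Finset.sum_add_distrib]
    refine Finset.sum_le_sum fun i _ => ?_
    rw [h2]
    calc _ = |a * (p i - ∫ y, w i y ∂ν) + b * (p' i - ∫ y, w' i y ∂ν)| := by ring_nf
      _ ≤ |a * (p i - ∫ y, w i y ∂ν)| + |b * (p' i - ∫ y, w' i y ∂ν)| := abs_add_le _ _
      _ = _ := by rw [abs_mul, abs_mul, abs_of_nonneg ha, abs_of_nonneg hb]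
  unfold penalizedCost
  rw [h1]
  nlinarith [mul_le_mul_of_nonneg_left h3 hL]

/-- A lower bound for the penalized cost at `p` extends to an affine lower bound at all masses. -/
lemma exists_subgradient_penalizedCost [Nonempty ι] [IsFiniteMeasure ν]
    (hci : ∀ i, Integrable (c i) ν) {L : ℝ} (hL : 0 ≤ L) {p : ι → ℝ} {V : ℝ}
    (hV : ∀ w, IsMeasurablePartition w → V ≤ penalizedCost c L ν p w) :
    ∃ g : ι → ℝ, ∀ (q : ι → ℝ) (w : ι → Y → ℝ), IsMeasurablePartition w →
      V + ∑ i, g i * (q i - p i) ≤ penalizedCost c L ν q w := by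
  classical
  -- `C` is the strict epigraph of the value function `q ↦ inf_w penalizedCost c L ν q w`. Joint
  -- convexity makes it convex, and the hypothesis on `V` keeps `(p, V)` outside.
  let C : Set ((ι → ℝ) × ℝ) :=
    ⋃ (w : ι → Y → ℝ) (_ : IsMeasurablePartition w), {x | penalizedCost c L ν x.1 w < x.2}
  have hmem : ∀ q t, (q, t) ∈ C ↔
      ∃ w, IsMeasurablePartition w ∧ penalizedCost c L ν q w < t := by
    intro q t
    simp [C]
  have hopen : IsOpen C := by
    refine isOpen_iUnion fun w => isOpen_iUnion fun _ => isOpen_lt ?_ continuous_snd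
    unfold penalizedCost
    fun_prop
  have hconv : Convex ℝ C := by
    rintro ⟨q, t⟩ hx ⟨q', t'⟩ hx' a b ha hb hab
    obtain ⟨w, hw, hwt⟩ := (hmem _ _).1 hx
    obtain ⟨w', hw', hwt'⟩ := (hmem _ _).1 hx'
    refine (hmem _ _).2 ⟨_, hw.convexCombination hw' ha hb hab, ?_⟩
    refine (penalizedCost_convexCombination hci hL hw hw' q q' ha hb).trans_lt ?_
    change _ < a * t + b * t'
    rcases ha.eq_or_lt with rfl | ha
    · obtain rfl : b = 1 := by linarith
      simpa using hwt'
    · nlinarith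
  have hnot : (p, V) ∉ C := by
    rw [hmem]
    rintro ⟨w, hw, h⟩
    exact absurd (hV w hw) (not_le.2 h)
  obtain ⟨f, hf⟩ := geometric_hahn_banach_open_point hconv hopen hnot
  set u : ι → ℝ := fun i => f (Pi.single i 1, 0)
  set b : ℝ := f (0, 1)
  have hfx : ∀ q t, f (q, t) = ∑ i, q i * u i + t * b := by
    intro q t
    have : ((q, t) : (ι → ℝ) × ℝ)
        = ∑ i, q i • ((Pi.single i 1, 0) : (ι → ℝ) × ℝ) + t • ((0, 1) : (ι → ℝ) × ℝ) := by
      refine Prod.ext ?_ ?_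
      · ext j
        simp [Prod.fst_sum, Finset.sum_apply, Pi.single_apply]
      · simp [Prod.snd_sum]
    rw [this, map_add, map_sum]
    simp_rw [map_smul]
    rfl
  -- The separating hyperplane is not vertical, since `C` contains a point above `(p, V)`. Its slope
  -- `u / (-b)` is then the subgradient.
  have hb : b < 0 := by
    have i₀ : ι := Classical.arbitrary ι
    have hw := isMeasurablePartition_single (Y := Y) i₀
    have h := hf (p, max (penalizedCost c L ν p _) V + 1)
      ((hmem _ _).2 ⟨_, hw, (le_max_left _ V).trans_lt (lt_add_one _)⟩)
    rw [hfx, hfx] at h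
    by_contra hb
    nlinarith [le_max_right (penalizedCost c L ν p
      fun (j : ι) (_ : Y) => if j = i₀ then (1 : ℝ) else 0) V]
  refine ⟨fun i => u i / (-b), fun q w hw => le_of_forall_gt_imp_ge_of_dense fun t ht => ?_⟩
  have h := hf (q, t) ((hmem _ _).2 ⟨w, hw, ht⟩)
  rw [hfx, hfx] at h
  have e : ∑ i, u i / (-b) * (q i - p i) = (∑ i, q i * u i - ∑ i, p i * u i) / (-b) := by
    rw [← Finset.sum_sub_distrib, Finset.sum_div]
    exact Finset.sum_congr rfl fun i _ => by ring
  rw [e]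
  have : (∑ i, q i * u i - ∑ i, p i * u i) / (-b) < t - V := by
    rw [div_lt_iff₀ (by linarith)]
    nlinarith
  linarith

/-- Strong duality for the semi-discrete transport problem with penalized masses: the dual
potential can be taken bounded by the penalization parameter. -/
theorem exists_dual_potential [Nonempty ι] [IsProbabilityMeasure ν]
    (hc : ∀ i, Measurable (c i)) (hci : ∀ i, Integrable (c i) ν) {L : ℝ} (hL : 0 ≤ L)
    {p : ι → ℝ} {V : ℝ} (hV : ∀ w, IsMeasurablePartition w → V ≤ penalizedCost c L ν p w) :
    ∃ g : ι → ℝ, (∀ i, |g i| ≤ L) ∧ V ≤ ∑ i, p i * g i + ∫ y, cTransform c g y ∂ν := by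
  classical
  obtain ⟨g, hg⟩ := exists_subgradient_penalizedCost hci hL hV
  refine ⟨g, fun i => ?_, ?_⟩
  · have hw := isMeasurablePartition_single (Y := Y) i
    set w := fun (j : ι) (_ : Y) => if j = i then (1 : ℝ) else 0
    -- The penalized cost is `L`-Lipschitz in each mass, so its affine minorant has slopes at most
    -- `L`; letting `s` grow in either direction shows this.
    have key : ∀ s : ℝ, V + s * g i ≤ penalizedCost c L ν p w + L * |s| := by
      intro s
      have h := hg (fun j => p j + if j = i then s else 0) w hw
      have e : ∑ j, g j * ((p j + if j = i then s else 0) - p j) = s * g i := by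
        simp [mul_comm]
      rw [e] at h
      refine h.trans ?_
      unfold penalizedCost
      have : ∑ j, |(p j + if j = i then s else 0) - ∫ y, w j y ∂ν|
          ≤ ∑ j, |p j - ∫ y, w j y ∂ν| + |s| := by
        calc _ ≤ ∑ j, (|p j - ∫ y, w j y ∂ν| + |if j = i then s else 0|) := by
              refine Finset.sum_le_sum fun j _ => ?_
              rw [add_sub_right_comm]
              exact abs_add_le _ _
          _ = _ := by
              rw [Finset.sum_add_distrib]
              simp [apply_ite abs]
      nlinarith [mul_le_mul_of_nonneg_left this hL]
    have key' : ∀ s : ℝ, 0 ≤ s → s * (|g i| - L) ≤ penalizedCost c L ν p w - V := by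
      intro s hs
      rcases abs_cases (g i) with ⟨h, _⟩ | ⟨h, _⟩
      · have := key s
        rw [abs_of_nonneg hs] at this
        rw [h]
        linarith
      · have := key (-s)
        rw [abs_neg, abs_of_nonneg hs] at this
        rw [h]
        linarith
    by_contra! h
    have hpos : 0 < |g i| - L := by linarith
    have h0 := key' 0 le_rfl
    have := key' ((penalizedCost c L ν p w - V + 1) / (|g i| - L))
      (div_nonneg (by linarith) hpos.le)
    rw [div_mul_cancel₀ _ hpos.ne'] at this
    linarith
  · obtain ⟨w, hw, hwg⟩ := exists_partition_eq_cTransform (g := g) hc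
    have h := hg (fun i => ∫ y, w i y ∂ν) w hw
    have e : ∫ y, cTransform c g y ∂ν
        = ∫ y, ∑ i, w i y * c i y ∂ν - ∑ i, g i * ∫ y, w i y ∂ν := by
      have h1 : ∑ i, g i * ∫ y, w i y ∂ν = ∫ y, ∑ i, g i * w i y ∂ν := by
        rw [integral_finsetSum _ fun i _ => (hw.integrable i).const_mul _]
        simp_rw [integral_const_mul]
      rw [h1, ← integral_sub (hw.integrable_sum_mul hci)
        (integrable_finsetSum _ fun i _ => (hw.integrable i).const_mul _)]
      congr with y
      rw [← hwg, ← Finset.sum_sub_distrib]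
      exact Finset.sum_congr rfl fun i _ => by ring
    have e' : ∑ i, g i * (∫ y, w i y ∂ν - p i)
        = ∑ i, g i * ∫ y, w i y ∂ν - ∑ i, p i * g i := by
      rw [← Finset.sum_sub_distrib]
      exact Finset.sum_congr rfl fun i _ => by ring
    rw [e'] at h
    simp only [penalizedCost, sub_self, abs_zero, Finset.sum_const_zero, mul_zero, add_zero] at h
    rw [e]
    linarith

end Duality

/-! ### Exactness of the penalty. -/

section Repair

variable {ι : Type*} [Fintype ι]

/-- Two probability vectors `q` and `p` are related by a stochastic matrix that moves mass at most
the `ℓ¹`-distance of `p` and `q`. -/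
lemma exists_stochastic_matrix {q p : ι → ℝ} (hq : ∀ i, 0 ≤ q i) (hp : ∀ i, 0 ≤ p i)
    (hq1 : ∑ i, q i = 1) (hp1 : ∑ i, p i = 1) :
    ∃ T : ι → ι → ℝ, (∀ j i, 0 ≤ T j i) ∧ (∀ j, ∑ i, T j i = 1) ∧
      (∀ i, ∑ j, q j * T j i = p i) ∧ ∑ j, q j * (1 - T j j) ≤ ∑ j, |p j - q j| := by
  classical
  -- Each site keeps `min (q i) (p i)`; the excess, of total mass `τ`, is distributed in proportion
  -- `r` to the deficits. If `τ = 0` any probability vector serves as `r`.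
  set τ : ℝ := ∑ i, (p i - min (q i) (p i)) with hτ
  have hgap : ∀ i, 0 ≤ p i - min (q i) (p i) := fun i => sub_nonneg.2 (min_le_right _ _)
  have hτ0 : 0 ≤ τ := Finset.sum_nonneg fun i _ => hgap i
  obtain ⟨r, hr0, hr1, hrτ⟩ : ∃ r : ι → ℝ, (∀ i, 0 ≤ r i) ∧ ∑ i, r i = 1 ∧
      ∀ i, r i * τ = p i - min (q i) (p i) := by
    rcases hτ0.eq_or_lt with h | h
    · refine ⟨p, hp, hp1, fun i => ?_⟩
      have := (Finset.sum_eq_zero_iff_of_nonneg fun i _ => hgap i).1 h.symm i (Finset.mem_univ i)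
      rw [this, ← h, mul_zero]
    · refine ⟨fun i => (p i - min (q i) (p i)) / τ, fun i => div_nonneg (hgap i) hτ0, ?_,
        fun i => div_mul_cancel₀ _ h.ne'⟩
      rw [← Finset.sum_div, ← hτ, div_self h.ne']
  -- The fraction of mass retained at `j`. When `q j = 0` the quotient is `0` by convention, which
  -- is harmless because only `q j * s j` matters.
  set s : ι → ℝ := fun j => min 1 (p j / q j)
  have hs0 : ∀ j, 0 ≤ s j := fun j => le_min zero_le_one (div_nonneg (hp j) (hq j))
  have hs1 : ∀ j, 0 ≤ 1 - s j := fun j => sub_nonneg.2 (min_le_left _ _)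
  have hqs : ∀ j, q j * s j = min (q j) (p j) := by
    intro j
    rcases (hq j).eq_or_lt with h | h
    · rw [← h, zero_mul, min_eq_left (hp j)]
    · rw [← mul_min_of_nonneg _ _ (hq j) |>.symm, mul_one, mul_div_cancel₀ _ h.ne']
  refine ⟨fun j i => (if j = i then s j else 0) + (1 - s j) * r i, fun j i => ?_, fun j => ?_,
    fun i => ?_, Finset.sum_le_sum fun j _ => ?_⟩
  · have := mul_nonneg (hs1 j) (hr0 i)
    have := hs0 j
    positivity
  · rw [Finset.sum_add_distrib, ← Finset.mul_sum, hr1]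
    simp
  · have h1 : ∑ j, q j * (1 - s j) = τ := by
      simp_rw [mul_sub, mul_one, hqs, hτ, Finset.sum_sub_distrib, hq1, hp1]
    simp_rw [mul_add, Finset.sum_add_distrib, ← mul_assoc, ← Finset.sum_mul]
    rw [h1, mul_comm τ, hrτ]
    simp [hqs]
  · have h1 : 0 ≤ (1 - s j) * r j := mul_nonneg (hs1 j) (hr0 j)
    calc q j * (1 - ((if j = j then s j else 0) + (1 - s j) * r j))
        ≤ q j * (1 - s j) := by
          refine mul_le_mul_of_nonneg_left ?_ (hq j)
          simp only [if_true]
          linarith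
      _ = q j - min (q j) (p j) := by rw [mul_sub, hqs, mul_one]
      _ ≤ |p j - q j| := by
          rcases le_total (q j) (p j) with h | h
          · simp [h]
          · rw [min_eq_right h, abs_sub_comm]
            exact le_abs_self _

variable {Y : Type*} [MeasurableSpace Y] {ν : Measure Y} [IsProbabilityMeasure ν]

/-- A partition can be modified to have prescribed masses, at a cost controlled by the penalized
cost. -/
lemma IsMeasurablePartition.exists_masses_eq {c : ι → Y → ℝ} {w : ι → Y → ℝ}
    (hw : IsMeasurablePartition w) (hci : ∀ i, Integrable (c i) ν) {D : ℝ}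
    (hD : 0 ≤ D) (hcD : ∀ i j y, c i y ≤ c j y + D) {p : ι → ℝ} (hp : ∀ i, 0 ≤ p i)
    (hp1 : ∑ i, p i = 1) :
    ∃ w' : ι → Y → ℝ, IsMeasurablePartition w' ∧ (∀ i, ∫ y, w' i y ∂ν = p i) ∧
      ∫ y, ∑ i, w' i y * c i y ∂ν ≤ penalizedCost c D ν p w := by
  obtain ⟨T, hT0, hT1, hTp, hTq⟩ := exists_stochastic_matrix
    (q := fun i => ∫ y, w i y ∂ν) (fun i => integral_nonneg (hw.nonneg i)) hp
    hw.sum_integral_eq_one hp1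
  have hw' : IsMeasurablePartition fun i y => ∑ j, w j y * T j i :=
    { measurable := fun i => Finset.measurable_sum _ fun j _ => (hw.measurable j).mul_const _
      nonneg := fun i y => Finset.sum_nonneg fun j _ => mul_nonneg (hw.nonneg j y) (hT0 j i)
      sum_eq_one := fun y => by
        rw [Finset.sum_comm]
        simp_rw [← Finset.mul_sum, hT1, mul_one]
        exact hw.sum_eq_one y }
  refine ⟨_, hw', fun i => ?_, ?_⟩
  · rw [integral_finsetSum _ fun j _ => (hw.integrable j).mul_const _]
    simp_rw [integral_mul_const]
    exact hTp i
  -- Mass that stays at `j` costs nothing extra; only the fraction `1 - T j j` pays the surcharge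
  -- `D`.
  · have hrow : ∀ j y, ∑ i, T j i * c i y ≤ c j y + D * (1 - T j j) := by
      classical
      intro j y
      calc ∑ i, T j i * c i y
          ≤ ∑ i, (T j i * (c j y + D) - if i = j then T j j * D else 0) := by
            refine Finset.sum_le_sum fun i _ => ?_
            split_ifs with h
            · subst h
              linarith
            · linarith [mul_le_mul_of_nonneg_left (hcD i j y) (hT0 j i)]
        _ = c j y + D * (1 - T j j) := by
            rw [Finset.sum_sub_distrib, ← Finset.sum_mul, hT1]
            simp only [Finset.sum_ite_eq', Finset.mem_univ, if_true]
            ring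
    have hint : Integrable (fun y => ∑ j, w j y * (D * (1 - T j j))) ν :=
      integrable_finsetSum _ fun j _ => (hw.integrable j).mul_const _
    calc ∫ y, ∑ i, (∑ j, w j y * T j i) * c i y ∂ν
        ≤ ∫ y, (∑ j, w j y * c j y + ∑ j, w j y * (D * (1 - T j j))) ∂ν := by
          refine integral_mono (hw'.integrable_sum_mul hci)
            ((hw.integrable_sum_mul hci).add hint) fun y => ?_
          simp_rw [Finset.sum_mul]
          rw [Finset.sum_comm, ← Finset.sum_add_distrib]
          refine Finset.sum_le_sum fun j _ => ?_
          simp_rw [mul_assoc, ← Finset.mul_sum]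
          rw [← mul_add]
          exact mul_le_mul_of_nonneg_left (hrow j y) (hw.nonneg j y)
      _ = ∫ y, ∑ j, w j y * c j y ∂ν + D * ∑ j, (∫ y, w j y ∂ν) * (1 - T j j) := by
          rw [integral_add (hw.integrable_sum_mul hci) hint,
            integral_finsetSum _ fun j _ => (hw.integrable j).mul_const _, Finset.mul_sum]
          simp_rw [integral_mul_const]
          congr 1
          exact Finset.sum_congr rfl fun j _ => by ring
      _ ≤ penalizedCost c D ν p w := by
          unfold penalizedCost
          gcongr

end Repair

/-! ### Couplings from partitions, and weak duality. -/

section TransportCost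

variable {ι X Y : Type*} [Fintype ι] [MeasurableSpace X] [MeasurableSpace Y]
  {c : X → Y → ℝ} {x : ι → X} {p : ι → ℝ} {ν : Measure Y}

/-- A partition whose masses are `p` gives a coupling of the discrete measure `∑ i, p i δ_{x i}`
with `ν`. -/
lemma IsMeasurablePartition.transportCost_le [IsFiniteMeasure ν] {w : ι → Y → ℝ}
    (hw : IsMeasurablePartition w) (hwp : ∀ i, ∫ y, w i y ∂ν = p i)
    (hc : Measurable fun z : X × Y => c z.1 z.2) (hc0 : ∀ i y, 0 ≤ c (x i) y)
    (hci : ∀ i, Integrable (c (x i)) ν) :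
    transportCost c (∑ i, ENNReal.ofReal (p i) • Measure.dirac (x i)) ν
      ≤ ENNReal.ofReal (∫ y, ∑ i, w i y * c (x i) y ∂ν) := by
  -- `ρ i` is the share of `ν` matched with the site `x i`.
  set ρ : ι → Measure Y := fun i => ν.withDensity fun y => ENNReal.ofReal (w i y)
  set π : Measure (X × Y) := ∑ i, (ρ i).map (Prod.mk (x i))
  have hwm : ∀ i, Measurable fun y => ENNReal.ofReal (w i y) := fun i =>
    (hw.measurable i).ennreal_ofReal
  have hπ : IsCoupling π (∑ i, ENNReal.ofReal (p i) • Measure.dirac (x i)) ν := by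
    constructor
    · rw [Measure.map_finset_sum' measurable_fst.aemeasurable]
      refine Finset.sum_congr rfl fun i _ => ?_
      rw [Measure.map_map measurable_fst measurable_prodMk_left]
      change Measure.map (fun _ => x i) (ρ i) = _
      rw [Measure.map_const, withDensity_apply _ MeasurableSet.univ, Measure.restrict_univ,
        ← ofReal_integral_eq_lintegral_ofReal (hw.integrable i) (.of_forall (hw.nonneg i)), hwp]
    · rw [Measure.map_finset_sum' measurable_snd.aemeasurable]
      have : ∀ i, Measure.map Prod.snd ((ρ i).map (Prod.mk (x i))) = ρ i := fun i => by
        rw [Measure.map_map measurable_snd measurable_prodMk_left]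
        exact Measure.map_id
      simp_rw [this]
      ext s hs
      rw [Measure.finsetSum_apply]
      simp_rw [ρ, withDensity_apply _ hs]
      rw [← lintegral_finsetSum _ fun i _ => hwm i]
      simp_rw [← ENNReal.ofReal_sum_of_nonneg fun i _ => hw.nonneg i _, hw.sum_eq_one]
      simp
  refine (iInf₂_le π hπ).trans_eq ?_
  rw [lintegral_finsetSum_measure, ofReal_integral_eq_lintegral_ofReal
    (hw.integrable_sum_mul hci) (.of_forall fun y => Finset.sum_nonneg fun i _ =>
      mul_nonneg (hw.nonneg i y) (hc0 i y))]
  have hcx : ∀ i, Measurable (c (x i)) := fun i => hc.comp measurable_prodMk_left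
  simp_rw [ENNReal.ofReal_sum_of_nonneg fun i _ => mul_nonneg (hw.nonneg i _) (hc0 i _)]
  rw [lintegral_finsetSum (f := fun i y => ENNReal.ofReal (w i y * c (x i) y)) _
    fun i _ => ((hw.measurable i).mul (hcx i)).ennreal_ofReal]
  refine Finset.sum_congr rfl fun i _ => ?_
  rw [lintegral_map hc.ennreal_ofReal measurable_prodMk_left,
    lintegral_withDensity_eq_lintegral_mul _ (hwm i) (hcx i).ennreal_ofReal]
  refine lintegral_congr fun y => ?_
  rw [Pi.mul_apply, ENNReal.ofReal_mul (hw.nonneg i y)]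

lemma ofReal_integral_le_lintegral_ofReal {α : Type*} [MeasurableSpace α] {μ : Measure α}
    {f : α → ℝ} (hf : Integrable f μ) :
    ENNReal.ofReal (∫ a, f a ∂μ) ≤ ∫⁻ a, ENNReal.ofReal (f a) ∂μ := by
  have h : ∀ a, ENNReal.ofReal (f a) = ENNReal.ofReal (max (f a) 0) := fun a => by simp
  simp_rw [h]
  rw [← ofReal_integral_eq_lintegral_ofReal hf.pos_part (.of_forall fun a => le_max_right _ _)]
  exact ENNReal.ofReal_le_ofReal
    (integral_mono hf hf.pos_part fun a => le_max_left _ _)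

/-- Weak duality for the Kantorovich problem. -/
lemma ofReal_integral_add_integral_le_transportCost {P : Measure X} {f : X → ℝ} {φ : Y → ℝ}
    (hf : Integrable f P) (hφ : Integrable φ ν)
    (hle : ∀ᵐ a ∂P, ∀ y, f a + φ y ≤ c a y) :
    ENNReal.ofReal (∫ a, f a ∂P + ∫ y, φ y ∂ν) ≤ transportCost c P ν := by
  refine le_iInf₂ fun π hπ => ?_
  obtain ⟨rfl, rfl⟩ := hπ
  have h1 : Integrable (fun z : X × Y => f z.1) π := hf.comp_measurable measurable_fst
  have h2 : Integrable (fun z : X × Y => φ z.2) π := hφ.comp_measurable measurable_snd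
  rw [integral_map measurable_fst.aemeasurable hf.aestronglyMeasurable,
    integral_map measurable_snd.aemeasurable hφ.aestronglyMeasurable, ← integral_add h1 h2]
  refine (ofReal_integral_le_lintegral_ofReal (h1.add h2)).trans (lintegral_mono_ae ?_)
  filter_upwards [ae_of_ae_map measurable_fst.aemeasurable hle] with z hz
  exact ENNReal.ofReal_le_ofReal (hz z.2)

/-- Weak duality asks for a function on all of `X`, so `g` is extended by zero off the sites;
injectivity of `x` makes this consistent, and the dual constraint is needed only at the sites. -/
lemma ofReal_dual_le_transportCost [MeasurableSingletonClass X] [Nonempty ι]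
    [IsFiniteMeasure ν] (hx : Function.Injective x) (hp : ∀ i, 0 ≤ p i)
    (hc : ∀ i, Measurable (c (x i))) (hci : ∀ i, Integrable (c (x i)) ν) (g : ι → ℝ) :
    ENNReal.ofReal (∑ i, p i * g i + ∫ y, cTransform (fun i => c (x i)) g y ∂ν)
      ≤ transportCost c (∑ i, ENNReal.ofReal (p i) • Measure.dirac (x i)) ν := by
  classical
  set G : X → ℝ := fun a => ∑ i, ({x i} : Set X).indicator (fun _ => g i) a
  have hG : ∀ i, G (x i) = g i := by
    intro i
    simp [G, Set.indicator_apply, hx.eq_iff]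
  have hGi : ∀ i, Integrable G (ENNReal.ofReal (p i) • Measure.dirac (x i)) := fun i =>
    (integrable_dirac (by simp)).smul_measure ENNReal.ofReal_ne_top
  have hGint : ∫ a, G a ∂(∑ i, ENNReal.ofReal (p i) • Measure.dirac (x i)) = ∑ i, p i * g i := by
    rw [integral_finsetSum_measure fun i _ => hGi i]
    refine Finset.sum_congr rfl fun i _ => ?_
    rw [integral_smul_measure, integral_dirac, hG, ENNReal.toReal_ofReal (hp i), smul_eq_mul]
  rw [← hGint]
  refine ofReal_integral_add_integral_le_transportCost
    (integrable_finsetSum_measure.2 fun i _ => hGi i) (integrable_cTransform hc hci) ?_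
  rw [ae_finsetSum_measure_iff]
  intro i _
  refine Measure.ae_smul_measure ?_ _
  rw [ae_dirac_eq]
  refine fun y => ?_
  rw [hG]
  linarith [cTransform_le (fun i => c (x i)) g y i]

end TransportCost

/-! ### The semi-discrete problem and its stability in the second marginal. -/

section SemiDiscrete

variable {ι X Y : Type*} [Fintype ι] [MeasurableSpace X] [MeasurableSpace Y]

/-- The standing assumptions on a semi-discrete transport problem: a probability vector `p` on
distinct sites `x i`, and a nonnegative measurable cost whose sections at two sites differ by at
most `D`. -/
structure IsSemiDiscreteProblem (c : X → Y → ℝ) (x : ι → X) (p : ι → ℝ) (D : ℝ) : Prop where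
  injective : Function.Injective x
  mass_nonneg : ∀ i, 0 ≤ p i
  sum_mass : ∑ i, p i = 1
  measurable_cost : Measurable fun z : X × Y => c z.1 z.2
  cost_nonneg : ∀ a y, 0 ≤ c a y
  osc_nonneg : 0 ≤ D
  cost_le_add : ∀ i j y, c (x i) y ≤ c (x j) y + D

/-- The transport cost from `∑ i, p i δ_{x i}` to `ν`, as a real number. -/
noncomputable def discreteTransportCost (c : X → Y → ℝ) (x : ι → X) (p : ι → ℝ)
    (ν : Measure Y) : ℝ :=
  (transportCost c (∑ i, ENNReal.ofReal (p i) • Measure.dirac (x i)) ν).toReal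

namespace IsSemiDiscreteProblem

variable {c : X → Y → ℝ} {x : ι → X} {p : ι → ℝ} {D : ℝ} {ν ν' : Measure Y}
  [IsProbabilityMeasure ν] [IsProbabilityMeasure ν']

lemma measurable_section (h : IsSemiDiscreteProblem c x p D) (i : ι) : Measurable (c (x i)) :=
  h.measurable_cost.comp measurable_prodMk_left

lemma nonempty (h : IsSemiDiscreteProblem c x p D) : Nonempty ι := by
  by_contra hι
  rw [not_nonempty_iff] at hι
  have := h.sum_mass
  simp at this

lemma transportCost_le_penalizedCost (h : IsSemiDiscreteProblem c x p D)
    (hci : ∀ i, Integrable (c (x i)) ν) {w : ι → Y → ℝ} (hw : IsMeasurablePartition w) :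
    transportCost c (∑ i, ENNReal.ofReal (p i) • Measure.dirac (x i)) ν
      ≤ ENNReal.ofReal (penalizedCost (fun i => c (x i)) D ν p w) := by
  obtain ⟨w', hw', hp', hle⟩ := hw.exists_masses_eq (c := fun i => c (x i)) hci h.osc_nonneg
    h.cost_le_add h.mass_nonneg h.sum_mass
  exact (hw'.transportCost_le hp' h.measurable_cost (fun i => h.cost_nonneg (x i)) hci).trans
    (ENNReal.ofReal_le_ofReal hle)

lemma transportCost_lt_top (h : IsSemiDiscreteProblem c x p D)
    (hci : ∀ i, Integrable (c (x i)) ν) :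
    transportCost c (∑ i, ENNReal.ofReal (p i) • Measure.dirac (x i)) ν < ∞ := by
  classical
  have := h.nonempty
  exact (h.transportCost_le_penalizedCost hci
    (isMeasurablePartition_single (Classical.arbitrary ι))).trans_lt ENNReal.ofReal_lt_top

lemma discreteTransportCost_le_penalizedCost (h : IsSemiDiscreteProblem c x p D)
    (hci : ∀ i, Integrable (c (x i)) ν) {w : ι → Y → ℝ} (hw : IsMeasurablePartition w) :
    discreteTransportCost c x p ν ≤ penalizedCost (fun i => c (x i)) D ν p w := by
  refine ENNReal.toReal_le_of_le_ofReal ?_ (h.transportCost_le_penalizedCost hci hw)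
  refine add_nonneg (integral_nonneg fun y => Finset.sum_nonneg fun i _ =>
    mul_nonneg (hw.nonneg i y) (h.cost_nonneg _ _)) (mul_nonneg h.osc_nonneg ?_)
  exact Finset.sum_nonneg fun i _ => abs_nonneg _

variable [Nonempty ι]

lemma dual_le_discreteTransportCost [MeasurableSingletonClass X]
    (h : IsSemiDiscreteProblem c x p D) (hci : ∀ i, Integrable (c (x i)) ν) (g : ι → ℝ) :
    ∑ i, p i * g i + ∫ y, cTransform (fun i => c (x i)) g y ∂ν
      ≤ discreteTransportCost c x p ν :=
  (ENNReal.ofReal_le_iff_le_toReal (h.transportCost_lt_top hci).ne).1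
    (ofReal_dual_le_transportCost h.injective h.mass_nonneg h.measurable_section hci g)

lemma exists_optimal_potential (h : IsSemiDiscreteProblem c x p D)
    (hci : ∀ i, Integrable (c (x i)) ν) :
    ∃ g : ι → ℝ, (∀ i, |g i| ≤ D) ∧ discreteTransportCost c x p ν
      ≤ ∑ i, p i * g i + ∫ y, cTransform (fun i => c (x i)) g y ∂ν :=
  exists_dual_potential h.measurable_section hci h.osc_nonneg
    fun _ hw => h.discreteTransportCost_le_penalizedCost hci hw

/-- Otherwise strong duality would give a potential of dual value at least the cost plus `ε`,
against weak duality. This produces a partition without disintegrating a coupling. -/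
lemma exists_partition_penalizedCost_lt [MeasurableSingletonClass X]
    (h : IsSemiDiscreteProblem c x p D) (hci : ∀ i, Integrable (c (x i)) ν) {ε : ℝ}
    (hε : 0 < ε) :
    ∃ w, IsMeasurablePartition w ∧
      penalizedCost (fun i => c (x i)) D ν p w < discreteTransportCost c x p ν + ε := by
  by_contra! hw
  obtain ⟨g, -, hg⟩ := exists_dual_potential h.measurable_section hci h.osc_nonneg hw
  linarith [h.dual_le_discreteTransportCost hci g]

/-- The transport costs to `ν` and to any `ν'` differ by the discrepancies of `ν` and `ν'` on a
fixed finite family of functions depending only on `ν`. -/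
lemma exists_abs_discreteTransportCost_sub_le [MeasurableSingletonClass X]
    (h : IsSemiDiscreteProblem c x p D) (hci : ∀ i, Integrable (c (x i)) ν) {ε : ℝ}
    (hε : 0 < ε) :
    ∃ (g : ι → ℝ) (w : ι → Y → ℝ), (∀ i, |g i| ≤ D) ∧ IsMeasurablePartition w ∧
      ∀ (ν' : Measure Y) [IsProbabilityMeasure ν'], (∀ i, Integrable (c (x i)) ν') →
        |discreteTransportCost c x p ν' - discreteTransportCost c x p ν|
          ≤ |∫ y, cTransform (fun i => c (x i)) g y ∂ν'
              - ∫ y, cTransform (fun i => c (x i)) g y ∂ν|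
            + |∫ y, ∑ i, w i y * c (x i) y ∂ν' - ∫ y, ∑ i, w i y * c (x i) y ∂ν|
            + D * ∑ i, |∫ y, w i y ∂ν' - ∫ y, w i y ∂ν| + ε := by
  obtain ⟨g, hgD, hg⟩ := h.exists_optimal_potential hci
  obtain ⟨w, hw, hwε⟩ := h.exists_partition_penalizedCost_lt hci hε
  refine ⟨g, w, hgD, hw, fun ν' _ hci' => ?_⟩
  have h1 := h.dual_le_discreteTransportCost hci' g
  have h2 := h.discreteTransportCost_le_penalizedCost hci' hw
  have h3 : ∑ i, |p i - ∫ y, w i y ∂ν'|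
      ≤ ∑ i, |p i - ∫ y, w i y ∂ν| + ∑ i, |∫ y, w i y ∂ν' - ∫ y, w i y ∂ν| := by
    rw [← Finset.sum_add_distrib]
    refine Finset.sum_le_sum fun i _ => ?_
    rw [abs_sub_comm (∫ y, w i y ∂ν')]
    exact abs_sub_le _ _ _
  have h4 := mul_le_mul_of_nonneg_left h3 h.osc_nonneg
  have h5 : 0 ≤ D * ∑ i, |∫ y, w i y ∂ν' - ∫ y, w i y ∂ν| :=
    mul_nonneg h.osc_nonneg (Finset.sum_nonneg fun i _ => abs_nonneg _)
  unfold penalizedCost at h2 hwε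
  set A := ∫ y, cTransform (fun i => c (x i)) g y ∂ν'
  set A' := ∫ y, cTransform (fun i => c (x i)) g y ∂ν
  set B := ∫ y, ∑ i, w i y * c (x i) y ∂ν'
  set B' := ∫ y, ∑ i, w i y * c (x i) y ∂ν
  -- The upper bound on the cost to `ν'` comes from `w`, the lower bound from `g`.
  rw [abs_sub_le_iff]
  constructor
  · linarith [le_abs_self (B - B'), abs_nonneg (A - A')]
  · linarith [neg_abs_le (A - A'), abs_nonneg (B - B')]

end IsSemiDiscreteProblem

end SemiDiscrete

/-! ### Mean deviation of empirical integrals. -/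

section Empirical

variable {E : Type*} [MeasurableSpace E] {m : ℕ}

lemma isProbabilityMeasure_empiricalMeasure (hm : 0 < m) (y : Fin m → E) :
    IsProbabilityMeasure (empiricalMeasure y) where
  measure_univ := by
    simp only [empiricalMeasure, Measure.smul_apply, Measure.finsetSum_apply, measure_univ,
      Finset.sum_const, Finset.card_univ, Fintype.card_fin, nsmul_eq_mul, mul_one, smul_eq_mul]
    exact ENNReal.inv_mul_cancel (by exact_mod_cast hm.ne') (ENNReal.natCast_ne_top m)

variable {Ω : Type*} [MeasurableSpace Ω] {μ : Measure Ω}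
  {Q : Measure E} {Y : Fin m → Ω → E} {f : E → ℝ}

lemma memLp_comp_of_hasLaw (hY : ∀ k, HasLaw (Y k) Q μ) (hf2 : MemLp f 2 Q) (k : Fin m) :
    MemLp (fun ω => f (Y k ω)) 2 μ := by
  have h := (hY k).map_eq
  rw [← h] at hf2
  exact hf2.comp_of_map (hY k).aemeasurable

variable [MeasurableSingletonClass E]

lemma integrable_empiricalMeasure (hm : 0 < m) (y : Fin m → E) (f : E → ℝ) :
    Integrable f (empiricalMeasure y) :=
  (integrable_finsetSum_measure.2 fun _ _ => integrable_dirac (by simp)).smul_measure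
    (ENNReal.inv_ne_top.2 (by exact_mod_cast hm.ne'))

lemma integral_empiricalMeasure (y : Fin m → E) (f : E → ℝ) :
    ∫ e, f e ∂(empiricalMeasure y) = (m : ℝ)⁻¹ * ∑ k, f (y k) := by
  rw [empiricalMeasure, integral_smul_measure,
    integral_finsetSum_measure fun _ _ => integrable_dirac (by simp)]
  simp

lemma memLp_integral_empiricalMeasure (hY : ∀ k, HasLaw (Y k) Q μ) (hf2 : MemLp f 2 Q) :
    MemLp (fun ω => ∫ e, f e ∂(empiricalMeasure fun k => Y k ω)) 2 μ := by
  simp_rw [integral_empiricalMeasure]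
  exact (memLp_finsetSum _ fun k _ => memLp_comp_of_hasLaw hY hf2 k).const_mul _

variable [IsProbabilityMeasure μ]

lemma integrable_abs_integral_empiricalMeasure_sub (hY : ∀ k, HasLaw (Y k) Q μ)
    (hf2 : MemLp f 2 Q) (a : ℝ) :
    Integrable (fun ω => |∫ e, f e ∂(empiricalMeasure fun k => Y k ω) - a|) μ :=
  (((memLp_integral_empiricalMeasure hY hf2).integrable one_le_two).sub
    (integrable_const a)).abs

lemma integral_abs_sub_le_sqrt_variance {Z : Ω → ℝ} (hZ : MemLp Z 2 μ) :
    ∫ ω, |Z ω - ∫ ω, Z ω ∂μ| ∂μ ≤ √(Var[Z; μ]) := by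
  refine Real.le_sqrt_of_sq_le ?_
  have hc : MemLp (fun ω => |Z ω - ∫ ω, Z ω ∂μ|) 2 μ := (hZ.sub (memLp_const _)).abs
  -- Jensen's inequality, read off from the nonnegative variance of the absolute deviation.
  have h := variance_nonneg (fun ω => |Z ω - ∫ ω, Z ω ∂μ|) μ
  rw [variance_eq_sub hc] at h
  rw [variance_eq_integral hZ.aemeasurable]
  simp only [Pi.pow_apply, sq_abs] at h
  linarith

/-- The mean absolute deviation of an empirical mean of `m` independent samples. -/
lemma integral_abs_integral_empiricalMeasure_sub_le (hm : 0 < m) (hY : ∀ k, HasLaw (Y k) Q μ)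
    (hind : iIndepFun Y μ) (hf : Measurable f) (hf2 : MemLp f 2 Q) :
    ∫ ω, |∫ e, f e ∂(empiricalMeasure fun k => Y k ω) - ∫ e, f e ∂Q| ∂μ
      ≤ √(Var[f; Q]) / √m := by
  have hm' : (0 : ℝ) < m := by exact_mod_cast hm
  have hmem := memLp_comp_of_hasLaw hY hf2
  have hmean : ∫ ω, ∫ e, f e ∂(empiricalMeasure fun k => Y k ω) ∂μ = ∫ e, f e ∂Q := by
    simp_rw [integral_empiricalMeasure]
    rw [integral_const_mul, integral_finsetSum _ fun k _ => (hmem k).integrable one_le_two]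
    have : ∀ k, ∫ ω, f (Y k ω) ∂μ = ∫ e, f e ∂Q := fun k =>
      (hY k).integral_comp hf2.aestronglyMeasurable
    simp_rw [this]
    rw [Finset.sum_const, Finset.card_univ, Fintype.card_fin, nsmul_eq_mul,
      inv_mul_cancel_left₀ hm'.ne']
  have hvar : Var[fun ω => ∫ e, f e ∂(empiricalMeasure fun k => Y k ω); μ] = Var[f; Q] / m := by
    simp_rw [integral_empiricalMeasure]
    rw [variance_const_mul]
    have e : (fun ω => ∑ k, f (Y k ω)) = ∑ k, fun ω => f (Y k ω) := by
      ext ω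
      simp
    rw [e, IndepFun.variance_sum fun k _ => hmem k]
    · have : ∀ k, Var[fun ω => f (Y k ω); μ] = Var[f; Q] := fun k => by
        rw [← (hY k).map_eq, variance_map hf.aemeasurable (hY k).aemeasurable]
        rfl
      simp_rw [this]
      rw [Finset.sum_const, Finset.card_univ, Fintype.card_fin, nsmul_eq_mul]
      field_simp
    · intro i _ j _ hij
      exact (hind.indepFun hij).comp hf hf
  have h := integral_abs_sub_le_sqrt_variance (memLp_integral_empiricalMeasure hY hf2)
  rwa [hmean, hvar, Real.sqrt_div' _ hm'.le] at h

end Empirical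

/-! ### Variance bounds for the test functions. -/

section Variance

variable {E : Type*} [NormedAddCommGroup E] [MeasurableSpace E] {Q : Measure E}
  [IsProbabilityMeasure Q]

lemma memLp_two_of_abs_sub_le (hQ : MemLp (fun y : E => y) 2 Q) {f : E → ℝ}
    (hf : Measurable f) {a b : ℝ} (hab : ∀ y, |f y - a| ≤ ‖y‖ + b) : MemLp f 2 Q := by
  have h : MemLp (fun y => f y - a) 2 Q :=
    (hQ.norm.add (memLp_const b)).mono' (hf.sub_const a).aestronglyMeasurable (.of_forall hab)
  refine (h.add (memLp_const a)).ae_eq (.of_forall fun y => ?_)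
  simp

lemma sqrt_variance_le_of_abs_sub_le (hQ : MemLp (fun y : E => y) 2 Q) {f : E → ℝ}
    (hf : Measurable f) {a b : ℝ} (hb : 0 ≤ b) (hab : ∀ y, |f y - a| ≤ ‖y‖ + b) :
    √(Var[f; Q]) ≤ b + √(∫ y, ‖y‖ ^ 2 ∂Q) := by
  have hf2 := memLp_two_of_abs_sub_le hQ hf hab
  have hN : Integrable (fun y : E => ‖y‖) Q := hQ.norm.integrable one_le_two
  have hN2 : Integrable (fun y : E => ‖y‖ ^ 2) Q := hQ.norm.integrable_sq
  set σ := √(∫ y, ‖y‖ ^ 2 ∂Q)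
  have hσ : σ ^ 2 = ∫ y, ‖y‖ ^ 2 ∂Q := Real.sq_sqrt (integral_nonneg fun y => sq_nonneg _)
  have hmean : ∫ y, ‖y‖ ∂Q ≤ σ := by
    refine Real.le_sqrt_of_sq_le ?_
    have h := variance_nonneg (fun y : E => ‖y‖) Q
    rw [variance_eq_sub hQ.norm] at h
    simp only [Pi.pow_apply] at h
    linarith
  rw [Real.sqrt_le_left (add_nonneg hb (Real.sqrt_nonneg _))]
  calc Var[f; Q] = Var[fun y => f y - a; Q] := (variance_sub_const hf2.aestronglyMeasurable a).symm
    _ ≤ ∫ y, (f y - a) ^ 2 ∂Q :=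
        variance_le_expectation_sq (hf.sub_const a).aestronglyMeasurable
    _ ≤ ∫ y, (‖y‖ ^ 2 + 2 * b * ‖y‖ + b ^ 2) ∂Q := by
        refine integral_mono (hf2.sub (memLp_const a)).integrable_sq
          ((hN2.fun_add (hN.const_mul _)).fun_add (integrable_const _)) fun y => ?_
        calc (f y - a) ^ 2 ≤ (‖y‖ + b) ^ 2 := sq_le_sq' (abs_le.1 (hab y)).1 (abs_le.1 (hab y)).2
          _ = _ := by ring
    _ = σ ^ 2 + 2 * b * ∫ y, ‖y‖ ∂Q + b ^ 2 := by
        rw [integral_add (hN2.fun_add (hN.const_mul _)) (integrable_const _),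
          integral_add hN2 (hN.const_mul _), integral_const_mul, hσ]
        simp
    _ ≤ (b + σ) ^ 2 := by nlinarith

-- Since `0 ≤ w i ≤ 1`, each variance is at most the mass of `w i`, and the masses sum to one.
-- Cauchy–Schwarz then gives the square root of the number of sites rather than the number itself.
omit [NormedAddCommGroup E] in
lemma IsMeasurablePartition.sum_sqrt_variance_le {ι : Type*} [Fintype ι] {w : ι → E → ℝ}
    (hw : IsMeasurablePartition w) : ∑ i, √(Var[w i; Q]) ≤ √(Fintype.card ι) := by
  have hvar : ∀ i, Var[w i; Q] ≤ ∫ y, w i y ∂Q := fun i => by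
    refine (variance_le_expectation_sq (hw.measurable i).aestronglyMeasurable).trans ?_
    refine integral_mono_of_nonneg (.of_forall fun y => sq_nonneg _) (hw.integrable i)
      (.of_forall fun y => ?_)
    simpa only [Pi.pow_apply] using pow_le_of_le_one (hw.nonneg i y) (hw.le_one i y) two_ne_zero
  refine Real.le_sqrt_of_sq_le (sq_sum_le_card_mul_sum_sq.trans ?_)
  simp_rw [Real.sq_sqrt (variance_nonneg _ _)]
  have : ∑ i, Var[w i; Q] ≤ 1 :=
    (Finset.sum_le_sum fun i _ => hvar i).trans_eq hw.sum_integral_eq_one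
  exact mul_le_of_le_one_right (Nat.cast_nonneg _) this

end Variance

/-! ### The norm cost and the deviation bound. -/

section NormCost

variable {ι E : Type*} [Fintype ι] [NormedAddCommGroup E] {x : ι → E} {D : ℝ}

lemma cTransform_norm_sub_le_add [Nonempty ι] (g : ι → ℝ) (y y' : E) :
    cTransform (fun i y => ‖x i - y‖) g y
      ≤ cTransform (fun i y => ‖x i - y‖) g y' + ‖y' - y‖ := by
  obtain ⟨i, hi⟩ := exists_cTransform_eq (fun i (y : E) => ‖x i - y‖) g y'
  rw [hi]
  have h1 := cTransform_le (fun i (y : E) => ‖x i - y‖) g y i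
  have h2 := norm_sub_le_norm_sub_add_norm_sub (x i) y' y
  linarith

/-- Subtracting the constant `‖x j‖`, which leaves the variance unchanged, makes the bound
independent of where the sites lie. One `D` comes from the choice of site, the other from `g`. -/
lemma abs_cTransform_norm_sub_sub_le [Nonempty ι] (hD : ∀ i j, ‖x i - x j‖ ≤ D) {g : ι → ℝ}
    (hg : ∀ i, |g i| ≤ D) (j : ι) (y : E) :
    |cTransform (fun i y => ‖x i - y‖) g y - ‖x j‖| ≤ ‖y‖ + 2 * D := by
  obtain ⟨i, hi⟩ := exists_cTransform_eq (fun i (y : E) => ‖x i - y‖) g y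
  have h1 : |‖x i - y‖ - ‖x j‖| ≤ ‖x i - y - x j‖ := abs_norm_sub_norm_le _ _
  have h2 : ‖x i - y - x j‖ ≤ ‖x i - x j‖ + ‖y‖ := by
    rw [sub_right_comm]
    exact norm_sub_le _ _
  have h3 := abs_le.1 (h1.trans h2)
  have h4 := abs_le.1 (hg i)
  have h5 := hD i j
  rw [hi, abs_le]
  constructor <;> linarith [h3.1, h3.2, h4.1, h4.2]

variable [MeasurableSpace E]

lemma abs_sum_mul_norm_sub_sub_le (hD : ∀ i j, ‖x i - x j‖ ≤ D) {w : ι → E → ℝ}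
    (hw : IsMeasurablePartition w) (j : ι) (y : E) :
    |∑ i, w i y * ‖x i - y‖ - ‖x j‖| ≤ ‖y‖ + D := by
  have e : ∑ i, w i y * ‖x i - y‖ - ‖x j‖ = ∑ i, w i y * (‖x i - y‖ - ‖x j‖) := by
    simp_rw [mul_sub]
    rw [Finset.sum_sub_distrib, ← Finset.sum_mul, hw.sum_eq_one, one_mul]
  rw [e]
  calc _ ≤ ∑ i, |w i y * (‖x i - y‖ - ‖x j‖)| := Finset.abs_sum_le_sum_abs _ _
    _ ≤ ∑ i, w i y * (‖y‖ + D) := by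
        refine Finset.sum_le_sum fun i _ => ?_
        rw [abs_mul, abs_of_nonneg (hw.nonneg i y)]
        refine mul_le_mul_of_nonneg_left ?_ (hw.nonneg i y)
        have h1 : |‖x i - y‖ - ‖x j‖| ≤ ‖x i - y - x j‖ := abs_norm_sub_norm_le _ _
        have h2 : ‖x i - y - x j‖ ≤ ‖x i - x j‖ + ‖y‖ := by
          rw [sub_right_comm]
          exact norm_sub_le _ _
        linarith [hD i j]
    _ = ‖y‖ + D := by rw [← Finset.sum_mul, hw.sum_eq_one, one_mul]

variable [BorelSpace E] [SecondCountableTopology E] {p : ι → ℝ} {m : ℕ}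

lemma isSemiDiscreteProblem_norm_sub [Nonempty ι] (hx : Function.Injective x)
    (hp : ∀ i, 0 ≤ p i) (hp1 : ∑ i, p i = 1) (hD : ∀ i j, ‖x i - x j‖ ≤ D) :
    IsSemiDiscreteProblem (fun a y : E => ‖a - y‖) x p D where
  injective := hx
  mass_nonneg := hp
  sum_mass := hp1
  measurable_cost := (measurable_fst.sub measurable_snd).norm
  cost_nonneg _ _ := norm_nonneg _
  osc_nonneg := (norm_nonneg _).trans (hD (Classical.arbitrary ι) (Classical.arbitrary ι))
  cost_le_add i j y := by
    have := norm_sub_le_norm_sub_add_norm_sub (x i) (x j) y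
    linarith [hD i j]

variable [Nonempty ι]

/-- The transport cost from a discrete measure to the empirical measure of `y` is a Lipschitz
function of `y`. -/
lemma lipschitzWith_discreteTransportCost_empiricalMeasure
    (h : IsSemiDiscreteProblem (fun a y : E => ‖a - y‖) x p D) (hm : 0 < m) :
    LipschitzWith 1 fun y : Fin m → E =>
      discreteTransportCost (fun a y : E => ‖a - y‖) x p (empiricalMeasure y) := by
  have hm' : (0 : ℝ) < m := by exact_mod_cast hm
  refine LipschitzWith.of_le_add fun y y' => ?_
  have := isProbabilityMeasure_empiricalMeasure hm y
  have := isProbabilityMeasure_empiricalMeasure hm y'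
  -- A potential optimal for `y` is admissible for `y'`, and its `c`-transform is 1-Lipschitz.
  obtain ⟨g, -, hg⟩ := h.exists_optimal_potential fun i => integrable_empiricalMeasure hm y _
  have hg' := h.dual_le_discreteTransportCost (fun i => integrable_empiricalMeasure hm y' _) g
  rw [integral_empiricalMeasure] at hg hg'
  have hle : (m : ℝ)⁻¹ * ∑ k, cTransform (fun i y => ‖x i - y‖) g (y k)
      ≤ (m : ℝ)⁻¹ * ∑ k, cTransform (fun i y => ‖x i - y‖) g (y' k) + dist y y' := by
    calc _ ≤ (m : ℝ)⁻¹ * ∑ k, (cTransform (fun i y => ‖x i - y‖) g (y' k) + dist y y') := by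
          gcongr with k
          refine (cTransform_norm_sub_le_add g (y k) (y' k)).trans ?_
          gcongr
          rw [← dist_eq_norm, dist_comm]
          exact dist_le_pi_dist y y' k
      _ = _ := by
          rw [Finset.sum_add_distrib, Finset.sum_const, Finset.card_univ, Fintype.card_fin,
            nsmul_eq_mul, mul_add, inv_mul_cancel_left₀ hm'.ne']
  linarith

/-- The expected deviation of the transport cost from a discrete measure on `N` sites to an
empirical measure is of order `√(N / m)`. -/
theorem integral_abs_discreteTransportCost_empiricalMeasure_sub_le
    (h : IsSemiDiscreteProblem (fun a y : E => ‖a - y‖) x p D) (hD : ∀ i j, ‖x i - x j‖ ≤ D)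
    (hm : 0 < m) {Q : Measure E} [IsProbabilityMeasure Q] (hQ : MemLp (fun y : E => y) 2 Q)
    {Ω : Type*} [MeasurableSpace Ω] {μ : Measure Ω} [IsProbabilityMeasure μ]
    {Y : Fin m → Ω → E} (hY : ∀ k, HasLaw (Y k) Q μ) (hind : iIndepFun Y μ) :
    Integrable (fun ω => |discreteTransportCost (fun a y : E => ‖a - y‖) x p
        (empiricalMeasure fun k => Y k ω)
      - discreteTransportCost (fun a y : E => ‖a - y‖) x p Q|) μ ∧
    ∫ ω, |discreteTransportCost (fun a y : E => ‖a - y‖) x p (empiricalMeasure fun k => Y k ω)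
      - discreteTransportCost (fun a y : E => ‖a - y‖) x p Q| ∂μ
      ≤ √(Fintype.card ι) / √m * (4 * D + 2 * √(∫ y, ‖y‖ ^ 2 ∂Q)) := by
  set c : E → E → ℝ := fun a y => ‖a - y‖
  set σ := √(∫ y, ‖y‖ ^ 2 ∂Q)
  set F : Ω → ℝ := fun ω => |discreteTransportCost c x p (empiricalMeasure fun k => Y k ω)
    - discreteTransportCost c x p Q|
  have hm' : (0 : ℝ) < √m := Real.sqrt_pos.2 (by exact_mod_cast hm)
  have j : ι := Classical.arbitrary ι
  have hci : ∀ i, Integrable (c (x i)) Q := fun i =>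
    ((memLp_const (x i)).sub hQ).norm.integrable one_le_two
  -- The cost is an infimum over couplings, so its measurability in `ω` is obtained from continuity
  -- in the sample.
  have hF : AEStronglyMeasurable F μ := by
    have hcont := (lipschitzWith_discreteTransportCost_empiricalMeasure h hm).continuous
    have hYm : AEMeasurable (fun ω k => Y k ω) μ :=
      aemeasurable_pi_lambda _ fun k => (hY k).aemeasurable
    exact ((hcont.measurable.comp_aemeasurable hYm).sub_const _).aestronglyMeasurable.norm
  have key : ∀ ε : ℝ, 0 < ε → Integrable F μ ∧
      ∫ ω, F ω ∂μ ≤ √(Fintype.card ι) / √m * (4 * D + 2 * σ) + ε := by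
    intro ε hε
    obtain ⟨g, w, hg, hw, hgw⟩ := h.exists_abs_discreteTransportCost_sub_le hci hε
    set φ : E → ℝ := cTransform (fun i => c (x i)) g
    set ψ : E → ℝ := fun y => ∑ i, w i y * c (x i) y
    have hφm : Measurable φ := measurable_cTransform h.measurable_section
    have hψm : Measurable ψ := Finset.measurable_sum _ fun i _ =>
      (hw.measurable i).mul (h.measurable_section i)
    have hφb := abs_cTransform_norm_sub_sub_le hD hg j
    have hψb := abs_sum_mul_norm_sub_sub_le hD hw j
    have hφ2 : MemLp φ 2 Q := memLp_two_of_abs_sub_le hQ hφm hφb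
    have hψ2 : MemLp ψ 2 Q := memLp_two_of_abs_sub_le hQ hψm hψb
    have hw2 : ∀ i, MemLp (w i) 2 Q := fun i =>
      MemLp.of_bound (hw.measurable i).aestronglyMeasurable 1
        (.of_forall fun y => hw.abs_le_one i y)
    have hFle : ∀ ω, F ω ≤ |∫ y, φ y ∂(empiricalMeasure fun k => Y k ω) - ∫ y, φ y ∂Q|
        + |∫ y, ψ y ∂(empiricalMeasure fun k => Y k ω) - ∫ y, ψ y ∂Q|
        + D * ∑ i, |∫ y, w i y ∂(empiricalMeasure fun k => Y k ω) - ∫ y, w i y ∂Q| + ε := by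
      intro ω
      have := isProbabilityMeasure_empiricalMeasure hm fun k => Y k ω
      exact hgw _ fun i => integrable_empiricalMeasure hm _ _
    have hI1 := integrable_abs_integral_empiricalMeasure_sub hY hφ2 (∫ y, φ y ∂Q)
    have hI2 := integrable_abs_integral_empiricalMeasure_sub hY hψ2 (∫ y, ψ y ∂Q)
    have hI3 := fun i =>
      integrable_abs_integral_empiricalMeasure_sub hY (hw2 i) (∫ y, w i y ∂Q)
    have hI3' := (integrable_finsetSum Finset.univ fun i _ => hI3 i).const_mul D
    have hI := ((hI1.fun_add hI2).fun_add hI3').fun_add (integrable_const (μ := μ) ε)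
    have hFi : Integrable F μ := by
      refine hI.mono' hF (.of_forall fun ω => ?_)
      rw [Real.norm_eq_abs, abs_of_nonneg (abs_nonneg _)]
      exact hFle ω
    refine ⟨hFi, ?_⟩
    have hE1 := integral_abs_integral_empiricalMeasure_sub_le hm hY hind hφm hφ2
    have hE2 := integral_abs_integral_empiricalMeasure_sub_le hm hY hind hψm hψ2
    have hE3 := fun i =>
      integral_abs_integral_empiricalMeasure_sub_le hm hY hind (hw.measurable i) (hw2 i)
    have hV1 := sqrt_variance_le_of_abs_sub_le hQ hφm
      (mul_nonneg zero_le_two h.osc_nonneg) hφb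
    have hV2 := sqrt_variance_le_of_abs_sub_le hQ hψm h.osc_nonneg hψb
    have hV3 := hw.sum_sqrt_variance_le (Q := Q)
    have hcard : 1 ≤ √(Fintype.card ι : ℝ) :=
      Real.one_le_sqrt.2 (by exact_mod_cast Fintype.card_pos)
    have hD0 := h.osc_nonneg
    have hσ0 : 0 ≤ σ := Real.sqrt_nonneg _
    calc ∫ ω, F ω ∂μ ≤ _ := integral_mono hFi hI hFle
      _ = ∫ ω, |∫ y, φ y ∂(empiricalMeasure fun k => Y k ω) - ∫ y, φ y ∂Q| ∂μ
          + ∫ ω, |∫ y, ψ y ∂(empiricalMeasure fun k => Y k ω) - ∫ y, ψ y ∂Q| ∂μ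
          + D * ∑ i, ∫ ω, |∫ y, w i y ∂(empiricalMeasure fun k => Y k ω) - ∫ y, w i y ∂Q| ∂μ
          + ε := by
        rw [← integral_finsetSum _ fun i _ => hI3 i, ← integral_const_mul, ← integral_add hI1 hI2,
          ← integral_add (hI1.fun_add hI2) hI3',
          integral_add ((hI1.fun_add hI2).fun_add hI3') (integrable_const ε)]
        simp
      -- The three terms bound the errors of the `c`-transform, of the transport integrand and of
      -- the cell masses.
      _ ≤ (2 * D + σ) / √m + (D + σ) / √m + D * (√(Fintype.card ι) / √m) + ε := by
        gcongr
        · exact hE1.trans (by gcongr)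
        · exact hE2.trans (by gcongr)
        · refine (Finset.sum_le_sum fun i _ => hE3 i).trans ?_
          rw [← Finset.sum_div]
          gcongr
      _ = (3 * D + 2 * σ + √(Fintype.card ι) * D) / √m + ε := by ring
      -- The factor `√N ≥ 1` is inserted in front of `3 * D + 2 * σ`.
      _ ≤ (√(Fintype.card ι) * (4 * D + 2 * σ)) / √m + ε := by
        gcongr
        nlinarith
      _ = _ := by ring
  exact ⟨(key 1 one_pos).1, le_of_forall_pos_le_add fun ε hε => (key ε hε).2⟩

end NormCost

/-! ### Reduction to Dirac masses and conclusion. -/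

/-- A measure that vanishes off a finite set is a combination of Dirac masses. -/
lemma eq_sum_smul_dirac_of_measure_compl_eq_zero {X : Type*} [MeasurableSpace X]
    [MeasurableSingletonClass X] {P : Measure X} [IsFiniteMeasure P] {S : Finset X}
    (hP : P (S : Set X)ᶜ = 0) :
    P = ∑ i : S, ENNReal.ofReal (P.real {(i : X)}) • Measure.dirac (i : X) := by
  have hmass : ∀ i, ENNReal.ofReal (P.real {i}) = P {i} := fun i => ofReal_measureReal
  ext t ht
  simp only [Measure.finsetSum_apply, Measure.smul_apply, hmass, smul_eq_mul]
  rw [Finset.sum_coe_sort S fun i => P {i} * Measure.dirac i t]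
  calc P t = P (t ∩ S) := (measure_inter_conull hP).symm
    _ = ∑ i ∈ S, P.restrict t {i} := by
        rw [sum_measure_singleton, Measure.restrict_apply S.measurableSet, Set.inter_comm]
    _ = _ := by
        refine Finset.sum_congr rfl fun i _ => ?_
        rw [Measure.restrict_apply (measurableSet_singleton i), Measure.dirac_apply' i ht]
        by_cases hi : i ∈ t
        · rw [Set.inter_eq_left.2 (Set.singleton_subset_iff.2 hi)]
          simp [hi]
        · rw [Set.singleton_inter_eq_empty.2 hi]
          simp [hi]

theorem theorem2 {d N m : ℕ} (hm : 0 < m)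
    (A : Set (EuclideanSpace ℝ (Fin d))) (hA : Bornology.IsBounded A)
    (S : Finset (EuclideanSpace ℝ (Fin d))) (hSA : (S : Set (EuclideanSpace ℝ (Fin d))) ⊆ A)
    (hS : S.card = N)
    (P : Measure (EuclideanSpace ℝ (Fin d))) [IsProbabilityMeasure P]
    (hP : P (S : Set (EuclideanSpace ℝ (Fin d)))ᶜ = 0)
    (Q : Measure (EuclideanSpace ℝ (Fin d))) [IsProbabilityMeasure Q]
    (hQ : MemLp (fun y : EuclideanSpace ℝ (Fin d) => y) 2 Q)
    {Ω : Type*} [MeasurableSpace Ω] (μ : Measure Ω) [IsProbabilityMeasure μ]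
    (Y : Fin m → Ω → EuclideanSpace ℝ (Fin d))
    (hY : ∀ k, HasLaw (Y k) Q μ) (hind : iIndepFun Y μ) :
    wasserstein1 P Q < ∞ ∧
    (∀ ω, wasserstein1 P (empiricalMeasure fun k => Y k ω) < ∞) ∧
    Integrable (fun ω => |(wasserstein1 P (empiricalMeasure fun k => Y k ω)).toReal
      - (wasserstein1 P Q).toReal|) μ ∧
    ∫ ω, |(wasserstein1 P (empiricalMeasure fun k => Y k ω)).toReal
      - (wasserstein1 P Q).toReal| ∂μ
      ≤ 8 * √(2 * (N : ℝ)) / √(m : ℝ) * boundConstant A Q := by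
  set x : S → EuclideanSpace ℝ (Fin d) := Subtype.val
  set p : S → ℝ := fun i => P.real {(i : EuclideanSpace ℝ (Fin d))}
  have hPsum : P = ∑ i, ENNReal.ofReal (p i) • Measure.dirac (x i) :=
    eq_sum_smul_dirac_of_measure_compl_eq_zero hP
  have hp1 : ∑ i, p i = 1 := by
    rw [Finset.sum_coe_sort S fun i => P.real {i}, sum_measureReal_singleton,
      measureReal_def, (prob_compl_eq_zero_iff S.measurableSet).1 hP, ENNReal.toReal_one]
  have : Nonempty S := by
    by_contra hne
    rw [not_nonempty_iff] at hne
    simp at hp1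
  have hD : ∀ i j, ‖x i - x j‖ ≤ Metric.diam A := fun i j => by
    rw [← dist_eq_norm]
    exact Metric.dist_le_diam_of_mem hA (hSA i.2) (hSA j.2)
  have h := isSemiDiscreteProblem_norm_sub Subtype.val_injective
    (fun i => measureReal_nonneg) hp1 hD
  have hci : ∀ i, Integrable (fun y => ‖x i - y‖) Q := fun i =>
    ((memLp_const (x i)).sub hQ).norm.integrable one_le_two
  have hW : ∀ ν, wasserstein1 P ν = transportCost (fun a y => ‖a - y‖)
      (∑ i, ENNReal.ofReal (p i) • Measure.dirac (x i)) ν := fun ν => by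
    rw [← hPsum]
    rfl
  simp_rw [hW]
  obtain ⟨hint, hle⟩ :=
    integral_abs_discreteTransportCost_empiricalMeasure_sub_le h hD hm hQ hY hind
  refine ⟨h.transportCost_lt_top hci, fun ω => ?_, hint, hle.trans ?_⟩
  · have := isProbabilityMeasure_empiricalMeasure hm fun k => Y k ω
    exact h.transportCost_lt_top fun i => integrable_empiricalMeasure hm _ _
  · have hcard : (Fintype.card S : ℝ) = N := by
      rw [Fintype.card_coe, hS]
    have hlog : 0 ≤ Real.log 2 := Real.log_nonneg one_le_two
    have hdiam : 0 ≤ Metric.diam A := Metric.diam_nonneg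
    have hsqrt : 1 ≤ √(2 * Metric.diam A + 1) := Real.one_le_sqrt.2 (by linarith)
    have hσ : 0 ≤ √(∫ y, ‖y‖ ^ 2 ∂Q) := Real.sqrt_nonneg _
    have hN : √(N : ℝ) ≤ √(2 * N) :=
      Real.sqrt_le_sqrt (by linarith [(Nat.cast_nonneg N : (0 : ℝ) ≤ N)])
    rw [hcard]
    -- The second factor of `boundConstant` is at least `1`, and the extra `2 * Metric.diam A` in
    -- the first is nonnegative.
    have hK : 4 * Metric.diam A + 2 * √(∫ y, ‖y‖ ^ 2 ∂Q) ≤ boundConstant A Q := by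
      unfold boundConstant
      nlinarith
    gcongr
    linarith [Real.sqrt_nonneg (N : ℝ)]
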